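/- **Noncommutative Wolff theorem.** Let $d\in\mathbb N$ and let $\mathbb M_d=\bigsqcup_{n\ge1}M_n(\mathbb C^d)$ be the set of $d$-tuples of $n\times n$ complex matrices, $n\ge 1$. For $\Omega\subseteq\mathbb M_d$ write $\Omega(n)=\Omega\cap M_n(\mathbb C^d)$. An *nc set* is a set closed under direct sums; an *nc domain* is an nc set that is open at each level and invariant under unitary similarities; an nc set $\Omega$ is *matrix convex* if $V^*XV\in\Omega(m)$ for all $X\in\Omega(n)$ and all isometries $V:\mathbb C^m\to\mathbb C^n$. An *nc function* is a graded function (it maps level $n$ to level $n$) that respects direct sums and similarities. Let $\mathcal H,\mathcal K$ be complex Hilbert spaces, let $\Omega_0\subseteq\mathbb M_d$ be an nc domain, let $Q:\Omega_0\to\bigsqcup_n M_n(B(\mathcal H,\mathcal K))$ be a locally bounded nc function, and put $$\Omega=\mathbb D_Q=\{Z\in\Omega_0 : Q(Z)Q(Z)^*<I\}=\{Z\in\Omega_0:\|Q(Z)\|<1\}.$$ Assume that $\Omega$ is bounded and matrix convex and that $0\in\Omega$. Let $f:\Omega\to\Omega$ be an nc function with no fixed points (at any level). For $X\in \Omega(n)$,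 $Y\in\Omega(m)$ and $Z\in M_{n,m}(\mathbb C^d)$ let $$\delta(X,Y)(Z)=\Big[\sup\Big\{t\in[0,\infty] : \begin{pmatrix}X&sZ\\0&Y\end{pmatrix}\in\Omega\ \text{ for all } s\in[0,t)\Big\}\Big]^{-1}\in[0,\infty]$$ be the nc Lempert function of $\Omega$, and for $X,Y\in\Omega(n)$ let $\widetilde\delta(X,Y)=\delta(X,Y)(X-Y)$. For $\zeta\in\partial\Omega(1)$ and $R>0$ define the small and big horospheres $E_R(\zeta)$ and $F_R(\zeta)$ by $$E_R(\zeta)(n)=\Big\{Z\in\Omega(n):\limsup_{w\to\zeta,\ w\in\Omega(1)}\widetilde\delta(0,w)^{-1}\,\widetilde\delta(Z,w\otimes I_n)<R\Big\},$$ $$F_R(\zeta)(n)=\Big\{Z\in\Omega(n):\liminf_{w\to\zeta,\ w\in\Omega(1)}\widetilde\delta(0,w)^{-1}\,\widetilde\delta(Z,w\otimes I_n)<R\Big\}.$$ Then there exists $\xi\in\partial\Omega(1)$ such that for every $R>0$ and every $k\in\mathbb N$, the $k$-th iterate of $f$ satisfies $f^{\circ k}(E_R(\xi))\subseteq F_R(\xi)$.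 -/

import Mathlib

open scoped ENNReal NNReal Topology

namespace NcIter

noncomputable section

/-- `M_{n,m}(E)`: the `n × m` matrices with entries in the vector space `E`.
For `E = ℂ^d` an element is the same thing as a `d`-tuple of `n × m` complex matrices. -/
abbrev Mat (n m : ℕ) (E : Type*) : Type _ := Matrix (Fin n) (Fin m) E

/-- A graded subset `⨆_n Ω(n)` of `𝕄(E) = ⨆_{n ≥ 1} M_n(E)`, given by its levels `Ω n`.
Only the levels `n ≥ 1` matter: every condition below is restricted to them. -/
abbrev GradedSet (E : Type*) : Type _ := ∀ n : ℕ, Set (Mat n n E)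

/-- A graded map `𝕄(E) → 𝕄(F)`, given by its levels `f n : M_n(E) → M_n(F)`. For a function on a
graded set `Ω`, only the values on `Ω` matter. -/
abbrev GradedMap (E F : Type*) : Type _ := ∀ n : ℕ, Mat n n E → Mat n n F

section Algebra

variable {E F : Type*} [AddCommGroup E] [Module ℂ E] [AddCommGroup F] [Module ℂ F]

/-- The product `A X B` of a matrix `X` over `E` with scalar matrices `A`, `B`. -/
def sandwich {n m p q : ℕ} (A : Matrix (Fin p) (Fin n) ℂ) (X : Mat n m E)
    (B : Matrix (Fin m) (Fin q) ℂ) : Mat p q E :=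
  fun i j => ∑ k, ∑ l, (A i k * B l j) • X k l

/-- The block upper triangular matrix `[X, Z; 0, Y]`. -/
def blockUpper {n m : ℕ} (X : Mat n n E) (Z : Mat n m E) (Y : Mat m m E) :
    Mat (n + m) (n + m) E :=
  Matrix.reindex finSumFinEquiv finSumFinEquiv (Matrix.fromBlocks X Z 0 Y)

/-- The direct sum `X ⊕ Y = [X, 0; 0, Y]`. -/
def directSum {n m : ℕ} (X : Mat n n E) (Y : Mat m m E) : Mat (n + m) (n + m) E :=
  blockUpper X 0 Y

/-- The ampliation `w ⊗ I_n` of a point `w` of the first level `M_1(E) = E`. -/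
def ampliation (n : ℕ) (w : Mat 1 1 E) : Mat n n E :=
  Matrix.diagonal fun _ => w 0 0

/-- An nc set: a graded set closed under direct sums. -/
def IsNcSet (Ω : GradedSet E) : Prop :=
  ∀ n m : ℕ, 0 < n → 0 < m → ∀ X ∈ Ω n, ∀ Y ∈ Ω m, directSum X Y ∈ Ω (n + m)

/-- An nc domain: an nc set that is open at every level and invariant under unitary
similarities. -/
structure IsNcDomain [TopologicalSpace E] (Ω : GradedSet E) : Prop where
  isNcSet : IsNcSet Ω
  isOpen : ∀ n : ℕ, 0 < n → IsOpen (Ω n)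
  unitary_mem : ∀ n : ℕ, 0 < n → ∀ X ∈ Ω n, ∀ U ∈ Matrix.unitaryGroup (Fin n) ℂ,
    sandwich U.conjTranspose X U ∈ Ω n

/-- A matrix convex set: an nc set closed under compressions `V^* X V` by isometries
`V : ℂ^m → ℂ^n`. -/
structure IsMatrixConvex (Ω : GradedSet E) : Prop where
  isNcSet : IsNcSet Ω
  compress_mem : ∀ n m : ℕ, 0 < n → 0 < m → ∀ X ∈ Ω n, ∀ V : Matrix (Fin n) (Fin m) ℂ,
    V.conjTranspose * V = 1 → sandwich V.conjTranspose X V ∈ Ω m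

/-- `f` is an nc function on `Ω`: it is graded (built into the type) and respects direct sums and
similarities. -/
structure IsNcFunction (Ω : GradedSet E) (f : GradedMap E F) : Prop where
  map_directSum : ∀ n m : ℕ, 0 < n → 0 < m → ∀ X ∈ Ω n, ∀ Y ∈ Ω m,
    f (n + m) (directSum X Y) = directSum (f n X) (f m Y)
  map_similarity : ∀ n : ℕ, 0 < n → ∀ X ∈ Ω n, ∀ S : (Matrix (Fin n) (Fin n) ℂ)ˣ,
    sandwich (S⁻¹).val X S.val ∈ Ω n →
      f n (sandwich (S⁻¹).val X S.val) = sandwich (S⁻¹).val (f n X) S.val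

/-- The nc Lempert function
`δ(X, Y)(Z) = (sup {t ∈ [0, ∞] | ∀ s ∈ [0, t), [X, s Z; 0, Y] ∈ Ω})⁻¹`, with values in `[0, ∞]`
and the conventions `0⁻¹ = ∞`, `∞⁻¹ = 0`. -/
def lempert (Ω : GradedSet E) {n m : ℕ} (X : Mat n n E) (Y : Mat m m E) (Z : Mat n m E) : ℝ≥0∞ :=
  (sSup {t : ℝ≥0∞ | ∀ s : ℝ≥0, (s : ℝ≥0∞) < t →
    blockUpper X (((s : ℝ) : ℂ) • Z) Y ∈ Ω (n + m)})⁻¹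

/-- `δ~(X, Y) = δ(X, Y)(X - Y)`. -/
def lempertDist (Ω : GradedSet E) {n : ℕ} (X Y : Mat n n E) : ℝ≥0∞ :=
  lempert Ω X Y (X - Y)

/-- The big horosphere `F_R(ζ)`, level by level; `w` tends to `ζ` through points of `Ω(1)`. -/
def bigHorosphere [TopologicalSpace E] (Ω : GradedSet E) (ζ : Mat 1 1 E) (R : ℝ) : GradedSet E :=
  fun n => {Z | Z ∈ Ω n ∧
    Filter.liminf (fun w : Mat 1 1 E =>
      (lempertDist Ω 0 w)⁻¹ * lempertDist Ω Z (ampliation n w)) (𝓝[Ω 1] ζ) < ENNReal.ofReal R}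

/-- The small horosphere `E_R(ζ)`, level by level; `w` tends to `ζ` through points of `Ω(1)`. -/
def smallHorosphere [TopologicalSpace E] (Ω : GradedSet E) (ζ : Mat 1 1 E) (R : ℝ) : GradedSet E :=
  fun n => {Z | Z ∈ Ω n ∧
    Filter.limsup (fun w : Mat 1 1 E =>
      (lempertDist Ω 0 w)⁻¹ * lempertDist Ω Z (ampliation n w)) (𝓝[Ω 1] ζ) < ENNReal.ofReal R}

end Algebra

section Bounded

/-- A graded set in `𝕄_d = 𝕄(ℂ^d)` is bounded if the coordinates of its points are bounded in
operator norm, uniformly over all levels. -/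
def IsBddNc {d : ℕ} (Ω : GradedSet (Fin d → ℂ)) : Prop :=
  ∃ C : ℝ, ∀ n : ℕ, 0 < n → ∀ X ∈ Ω n, ∀ k : Fin d,
    ‖Matrix.toEuclideanCLM (n := Fin n) (𝕜 := ℂ) (X.map fun x => x k)‖ ≤ C

end Bounded

section Operators

variable {E H K : Type*} [AddCommGroup E] [Module ℂ E] [TopologicalSpace E]
  [NormedAddCommGroup H] [InnerProductSpace ℂ H] [NormedAddCommGroup K] [InnerProductSpace ℂ K]

/-- The identification `M_n(B(H, K)) = B(H^n, K^n)`, where `H^n` and `K^n` are Hilbert space direct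
sums: `(T h)_i = ∑_j T_{ij} h_j`. -/
def toOp {n : ℕ} (T : Mat n n (H →L[ℂ] K)) :
    PiLp 2 (fun _ : Fin n => H) →L[ℂ] PiLp 2 (fun _ : Fin n => K) :=
  ((PiLp.continuousLinearEquiv 2 ℂ (fun _ : Fin n => K)).symm :
      (Fin n → K) →L[ℂ] PiLp 2 (fun _ : Fin n => K)) ∘L
    ContinuousLinearMap.pi fun i => ∑ j, T i j ∘L PiLp.proj 2 (fun _ : Fin n => H) j

/-- An nc analytic function on `Ω` with values in `𝕄(B(H, K))`: a locally bounded nc function. -/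
structure IsNcAnalytic (Ω : GradedSet E) (Q : GradedMap E (H →L[ℂ] K)) : Prop where
  isNcFunction : IsNcFunction Ω Q
  locallyBounded : ∀ n : ℕ, 0 < n → ∀ X ∈ Ω n, ∃ U ∈ 𝓝 X, ∃ C : ℝ,
    ∀ Y ∈ U ∩ Ω n, ‖toOp (Q n Y)‖ ≤ C

/-- `𝔻_Q = {Z ∈ Ω | Q(Z) Q(Z)^* < I}`. The strict operator inequality `T T^* < I` (that is,
`I - T T^*` is positive and invertible) says exactly that `‖T‖ < 1`. -/
def ncBall (Ω : GradedSet E) (Q : GradedMap E (H →L[ℂ] K)) : GradedSet E :=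
  fun n => {Z | Z ∈ Ω n ∧ ‖toOp (Q n Z)‖ < 1}

end Operators

end

end NcIter

/-! Only openness of `Ω` is taken from `Q`; the rest is a Wolff argument for open, bounded, matrix
convex sets. For `r < 1` the map `r f` strictly contracts the Lempert function, so an Earle–Hamilton
iteration (`exists_fixedPoint_smul`) gives a fixed point in `Ω(1)`. As `r → 1` these points
accumulate at some `ξ`; by continuity `ξ ∈ Ω(1)` would be fixed by `f`, so `ξ` lies on the boundary.

The ampliation of a fixed point `w` of `r f` is fixed at level `n`, so iterates of `r f` do not
increase `δ~(·, w ⊗ I_n)`. Dividing by `δ~(0, w)` and letting `r → 1` almost gives the claim, but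
`(r f)^k(Z)` must be replaced by its limit `f^k(Z)` while `w` escapes to the boundary. The
Harnack-type estimate `eventually_shear_mem` permits this at the cost of a factor arbitrarily close
to 1. It is uniform in `w` because, by `exists_push`, membership of a shear with parameter `t`
leaves room of order `t²` beyond its lower corner. -/

namespace NcIter

/-! ### Block matrices, compressing isometries and shears. -/

section Blocks

variable {E : Type*} [AddCommGroup E] {n m : ℕ}

@[simp] lemma blockUpper_castAdd_castAdd (X : Mat n n E) (Z : Mat n m E) (Y : Mat m m E)
    (i j : Fin n) : blockUpper X Z Y (Fin.castAdd m i) (Fin.castAdd m j) = X i j := by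
  simp [blockUpper]

@[simp] lemma blockUpper_castAdd_natAdd (X : Mat n n E) (Z : Mat n m E) (Y : Mat m m E)
    (i : Fin n) (j : Fin m) : blockUpper X Z Y (Fin.castAdd m i) (Fin.natAdd n j) = Z i j := by
  simp [blockUpper]

@[simp] lemma blockUpper_natAdd_castAdd (X : Mat n n E) (Z : Mat n m E) (Y : Mat m m E)
    (i : Fin m) (j : Fin n) : blockUpper X Z Y (Fin.natAdd n i) (Fin.castAdd m j) = 0 := by
  simp [blockUpper]

@[simp] lemma blockUpper_natAdd_natAdd (X : Mat n n E) (Z : Mat n m E) (Y : Mat m m E)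
    (i j : Fin m) : blockUpper X Z Y (Fin.natAdd n i) (Fin.natAdd n j) = Y i j := by
  simp [blockUpper]

lemma ext_blocks {α : Type*} {p q : ℕ} {A B : Matrix (Fin (n + m)) (Fin (p + q)) α}
    (h₁₁ : ∀ i j, A (Fin.castAdd m i) (Fin.castAdd q j) = B (Fin.castAdd m i) (Fin.castAdd q j))
    (h₁₂ : ∀ i j, A (Fin.castAdd m i) (Fin.natAdd p j) = B (Fin.castAdd m i) (Fin.natAdd p j))
    (h₂₁ : ∀ i j, A (Fin.natAdd n i) (Fin.castAdd q j) = B (Fin.natAdd n i) (Fin.castAdd q j))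
    (h₂₂ : ∀ i j, A (Fin.natAdd n i) (Fin.natAdd p j) = B (Fin.natAdd n i) (Fin.natAdd p j)) :
    A = B := by
  ext i j
  refine Fin.addCases (fun i => ?_) (fun i => ?_) i <;>
    refine Fin.addCases (fun j => ?_) (fun j => ?_) j
  exacts [h₁₁ i j, h₁₂ i j, h₂₁ i j, h₂₂ i j]

lemma castAdd_ne_natAdd (i : Fin n) (j : Fin m) : Fin.castAdd m i ≠ Fin.natAdd n j := by
  simp only [ne_eq, Fin.ext_iff, Fin.val_castAdd, Fin.val_natAdd]; omega

lemma natAdd_ne_castAdd (i : Fin n) (j : Fin m) : Fin.natAdd n j ≠ Fin.castAdd m i :=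
  (castAdd_ne_natAdd i j).symm

lemma blockUpper_add (X X' : Mat n n E) (Z Z' : Mat n m E) (Y Y' : Mat m m E) :
    blockUpper X Z Y + blockUpper X' Z' Y' = blockUpper (X + X') (Z + Z') (Y + Y') := by
  apply ext_blocks <;> intro i j <;> simp [-Fin.natAdd_eq_addNat]

lemma ampliation_one (w : Mat 1 1 E) : ampliation 1 w = w := by
  ext i j; simp [ampliation, Subsingleton.elim i 0, Subsingleton.elim j 0]

lemma ampliation_succ (n : ℕ) (w : Mat 1 1 E) :
    ampliation (n + 1) w = directSum (ampliation n w) w := by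
  apply ext_blocks <;> intro i j <;> simp [ampliation, directSum, -Fin.natAdd_eq_addNat, castAdd_ne_natAdd, natAdd_ne_castAdd, Matrix.diagonal_apply]
  simp [Subsingleton.elim i j, Subsingleton.elim j 0]

lemma ampliation_mem {Ω : GradedSet E} (hΩ : IsNcSet Ω) {w : Mat 1 1 E} (hw : w ∈ Ω 1) {n : ℕ} (hn : 0 < n) :
    ampliation n w ∈ Ω n := by
  induction n, hn using Nat.le_induction with
  | base => rwa [ampliation_one]
  | succ n hn ih => rw [ampliation_succ]; exact hΩ n 1 hn one_pos _ ih _ hw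

lemma zero_mem_level {Ω : GradedSet E} {n : ℕ} (hΩ : IsNcSet Ω) (h : 0 ∈ Ω 1) (hn : 0 < n) : 0 ∈ Ω n := by
  have : ampliation n (0 : Mat 1 1 E) = 0 := by ext i j; simp [ampliation, Matrix.diagonal_apply]
  rw [← this]; exact ampliation_mem hΩ h hn

variable [Module ℂ E]

lemma smul_blockUpper (c : ℂ) (X : Mat n n E) (Z : Mat n m E) (Y : Mat m m E) :
    c • blockUpper X Z Y = blockUpper (c • X) (c • Z) (c • Y) := by
  apply ext_blocks <;> intro i j <;> simp [-Fin.natAdd_eq_addNat]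

/-- The column `[a I; b I]`. -/
def scalarColumn (n : ℕ) (a b : ℝ) : Matrix (Fin (n + n)) (Fin n) ℂ :=
  Matrix.of fun i j => Fin.addCases (fun i => if i = j then (a : ℂ) else 0)
    (fun i => if i = j then (b : ℂ) else 0) i

@[simp] lemma scalarColumn_castAdd (a b : ℝ) (i j : Fin n) :
    scalarColumn n a b (Fin.castAdd n i) j = if i = j then (a : ℂ) else 0 := by
  simp [scalarColumn, -Fin.natAdd_eq_addNat]

@[simp] lemma scalarColumn_natAdd (a b : ℝ) (i j : Fin n) :
    scalarColumn n a b (Fin.natAdd n i) j = if i = j then (b : ℂ) else 0 := by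
  simp [scalarColumn, -Fin.natAdd_eq_addNat]

lemma scalarColumn_isometry {a b : ℝ} (h : a ^ 2 + b ^ 2 = 1) :
    (scalarColumn n a b).conjTranspose * scalarColumn n a b = 1 := by
  ext i j
  have h' : (a : ℂ) * a + b * b = 1 := by
    rw [← sq, ← sq]; exact_mod_cast h
  by_cases hij : i = j
  · subst hij
    simp [Matrix.mul_apply, -Fin.natAdd_eq_addNat, Fin.sum_univ_add, apply_ite (starRingEnd ℂ), h']
  · simp [Matrix.mul_apply, -Fin.natAdd_eq_addNat, Fin.sum_univ_add, apply_ite (starRingEnd ℂ), hij,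
      eq_comm (a := j) (b := i)]

lemma sandwich_scalarColumn (a b : ℝ) (X Z Y : Mat n n E) :
    sandwich (scalarColumn n a b).conjTranspose (blockUpper X Z Y) (scalarColumn n a b) =
      ((a ^ 2 : ℝ) : ℂ) • X + ((a * b : ℝ) : ℂ) • Z + ((b ^ 2 : ℝ) : ℂ) • Y := by
  ext i j
  simp [sandwich, -Fin.natAdd_eq_addNat, Fin.sum_univ_add, apply_ite (starRingEnd ℂ), ite_smul, Finset.sum_add_distrib, sq, add_assoc]

/-- The isometry `[I, 0; 0, a I; 0, b I]`. -/
def stretchIsometry (n : ℕ) (a b : ℝ) : Matrix (Fin (n + n + n)) (Fin (n + n)) ℂ :=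
  Matrix.of fun i j => Fin.addCases (fun i => if i = j then (Fin.addCases (fun _ => 1)
    (fun _ => (a : ℂ)) i : ℂ) else 0)
    (fun i => if Fin.natAdd n i = j then (b : ℂ) else 0) i

lemma stretchIsometry_isometry {a b : ℝ} (h : a ^ 2 + b ^ 2 = 1) :
    (stretchIsometry n a b).conjTranspose * stretchIsometry n a b = 1 := by
  have h' : (a : ℂ) * a + b * b = 1 := by
    rw [← sq, ← sq]; exact_mod_cast h
  apply ext_blocks <;> intro i j <;> by_cases hij : i = j <;>
  simp [stretchIsometry, -Fin.natAdd_eq_addNat, castAdd_ne_natAdd, natAdd_ne_castAdd, Matrix.mul_apply, Fin.sum_univ_add, apply_ite (starRingEnd ℂ), hij, h',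
    Matrix.one_apply, eq_comm (a := j) (b := i)]

/-- The corner `Y` enters with weight `a²` but `Z` only with `a`: a small off-diagonal entry is
quadratically cheap. -/
lemma sandwich_stretchIsometry (a b : ℝ) (X Z Y W : Mat n n E) :
    sandwich (stretchIsometry n a b).conjTranspose (directSum (blockUpper X Z Y) W)
      (stretchIsometry n a b) =
      blockUpper X ((a : ℂ) • Z) (((a ^ 2 : ℝ) : ℂ) • Y + ((b ^ 2 : ℝ) : ℂ) • W) := by
  apply ext_blocks <;> intro i j <;>
  simp [sandwich, -Fin.natAdd_eq_addNat, natAdd_ne_castAdd, stretchIsometry, directSum, Fin.sum_univ_add, apply_ite (starRingEnd ℂ),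
    ite_smul, Finset.sum_add_distrib, sq]

/-- The similarity `[I, t I; 0, I]`. -/
def shearMatrix (n : ℕ) (t : ℂ) : Matrix (Fin (n + n)) (Fin (n + n)) ℂ :=
  blockUpper 1 (t • (1 : Matrix (Fin n) (Fin n) ℂ)) 1

lemma shearMatrix_mul (s t : ℂ) : shearMatrix n s * shearMatrix n t = shearMatrix n (s + t) := by
  apply ext_blocks <;> intro i j <;>
  simp [shearMatrix, -Fin.natAdd_eq_addNat, Matrix.mul_apply, Fin.sum_univ_add, Matrix.one_apply]
  split_ifs <;> ring

lemma shearMatrix_zero : shearMatrix n 0 = 1 := by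
  apply ext_blocks <;> intro i j <;> simp [shearMatrix, -Fin.natAdd_eq_addNat, castAdd_ne_natAdd, natAdd_ne_castAdd, Matrix.one_apply]

/-- The similarity `[I, t I; 0, I]` as a unit. -/
def shearUnit (n : ℕ) (t : ℂ) : (Matrix (Fin (n + n)) (Fin (n + n)) ℂ)ˣ where
  val := shearMatrix n t
  inv := shearMatrix n (-t)
  val_inv := by simp [shearMatrix_mul, shearMatrix_zero]
  inv_val := by simp [shearMatrix_mul, shearMatrix_zero]

lemma sandwich_shearUnit (t : ℂ) (X Y : Mat n n E) :
    sandwich ((shearUnit n t)⁻¹).val (directSum X Y) (shearUnit n t).val =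
      blockUpper X (t • (X - Y)) Y := by
  change sandwich (shearMatrix n (-t)) (directSum X Y) (shearMatrix n t) = _
  apply ext_blocks <;> intro i j <;>
  simp [sandwich, -Fin.natAdd_eq_addNat, shearMatrix, directSum, Fin.sum_univ_add, Matrix.one_apply,
    ite_smul, Finset.sum_add_distrib, sub_eq_add_neg]

end Blocks

/-! ### Nc functions on upper triangular points. -/

section NcFunction

variable {E F : Type*} [AddCommGroup E] [Module ℂ E] [AddCommGroup F] [Module ℂ F]
  {Ω : GradedSet E}

/-- The shear similarity turns `X ⊕ Y` into this triangular point, so the nc axioms determine its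
image. -/
lemma IsNcFunction.map_blockUpper {f : GradedMap E F} (hf : IsNcFunction Ω f) (hΩ : IsNcSet Ω)
    {n : ℕ} (hn : 0 < n) {X Y : Mat n n E} (hX : X ∈ Ω n) (hY : Y ∈ Ω n) (t : ℂ)
    (h : blockUpper X (t • (X - Y)) Y ∈ Ω (n + n)) :
    f (n + n) (blockUpper X (t • (X - Y)) Y) =
      blockUpper (f n X) (t • (f n X - f n Y)) (f n Y) := by
  have h₁ := hf.map_similarity (n + n) (by omega) _ (hΩ n n hn hn X hX Y hY) (shearUnit n t)
  rw [sandwich_shearUnit, hf.map_directSum n n hn hn X hX Y hY, sandwich_shearUnit] at h₁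
  exact h₁ h

lemma IsNcFunction.shear_mem {f : GradedMap E E} (hf : IsNcFunction Ω f) (hΩ : IsNcSet Ω)
    (hmaps : ∀ n : ℕ, 0 < n → Set.MapsTo (f n) (Ω n) (Ω n)) {n : ℕ} (hn : 0 < n)
    {X Y : Mat n n E} (hX : X ∈ Ω n) (hY : Y ∈ Ω n) (t : ℂ)
    (h : blockUpper X (t • (X - Y)) Y ∈ Ω (n + n)) :
    blockUpper (f n X) (t • (f n X - f n Y)) (f n Y) ∈ Ω (n + n) := by
  rw [← hf.map_blockUpper hΩ hn hX hY t h]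
  exact hmaps (n + n) (by omega) h

lemma IsNcFunction.map_ampliation {f : GradedMap E F} (hf : IsNcFunction Ω f) (hΩ : IsNcSet Ω)
    {w : Mat 1 1 E} (hw : w ∈ Ω 1) {n : ℕ} (hn : 0 < n) :
    f n (ampliation n w) = ampliation n (f 1 w) := by
  induction n, hn using Nat.le_induction with
  | base => simp [ampliation_one]
  | succ n hn ih =>
    rw [ampliation_succ, hf.map_directSum n 1 hn one_pos _ (ampliation_mem hΩ hw hn) _ hw, ih,
      ampliation_succ]

end NcFunction

/-! ### Consequences of matrix convexity. -/

section Convex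

variable {E : Type*} [AddCommGroup E] [Module ℂ E] {Ω : GradedSet E} {n : ℕ}

lemma IsMatrixConvex.compress_blockUpper (hΩ : IsMatrixConvex Ω) (hn : 0 < n)
    {X Z Y : Mat n n E} (h : blockUpper X Z Y ∈ Ω (n + n)) {a b : ℝ} (hab : a ^ 2 + b ^ 2 = 1) :
    ((a ^ 2 : ℝ) : ℂ) • X + ((a * b : ℝ) : ℂ) • Z + ((b ^ 2 : ℝ) : ℂ) • Y ∈ Ω n := by
  rw [← sandwich_scalarColumn]
  exact hΩ.compress_mem _ _ (by omega) hn _ h _ (scalarColumn_isometry hab)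

lemma IsMatrixConvex.combo_mem (hΩ : IsMatrixConvex Ω) (hn : 0 < n) {X Y : Mat n n E}
    (hX : X ∈ Ω n) (hY : Y ∈ Ω n) {a b : ℝ} (ha : 0 ≤ a) (hb : 0 ≤ b) (hab : a + b = 1) :
    (a : ℂ) • X + (b : ℂ) • Y ∈ Ω n := by
  have h := hΩ.compress_blockUpper hn (hΩ.isNcSet n n hn hn X hX Y hY)
    (a := √a) (b := √b) (by rw [Real.sq_sqrt ha, Real.sq_sqrt hb, hab])
  rwa [Real.sq_sqrt ha, Real.sq_sqrt hb, smul_zero, add_zero] at h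

lemma IsMatrixConvex.smul_mem (hΩ : IsMatrixConvex Ω) (h0 : 0 ∈ Ω 1) (hn : 0 < n) {X : Mat n n E}
    (hX : X ∈ Ω n) {r : ℝ} (hr : 0 ≤ r) (hr1 : r ≤ 1) : (r : ℂ) • X ∈ Ω n := by
  have h := hΩ.combo_mem hn hX (zero_mem_level hΩ.isNcSet h0 hn) hr (sub_nonneg.2 hr1)
    (by ring)
  rwa [smul_zero, add_zero] at h

lemma IsMatrixConvex.stretch_mem (hΩ : IsMatrixConvex Ω) (hn : 0 < n) {X Z Y W : Mat n n E}
    (h : blockUpper X Z Y ∈ Ω (n + n)) (hW : W ∈ Ω n) {a : ℝ} (ha : a ^ 2 ≤ 1) :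
    blockUpper X ((a : ℂ) • Z) (((a ^ 2 : ℝ) : ℂ) • Y + ((1 - a ^ 2 : ℝ) : ℂ) • W) ∈
      Ω (n + n) := by
  have hb : √(1 - a ^ 2) ^ 2 = 1 - a ^ 2 := Real.sq_sqrt (sub_nonneg.2 ha)
  have h' := hΩ.compress_mem _ (n + n) (by omega) (by omega) _
    (hΩ.isNcSet (n + n) n (by omega) hn _ h _ hW) _
    (stretchIsometry_isometry (a := a) (b := √(1 - a ^ 2)) (by rw [hb]; ring))
  rwa [sandwich_stretchIsometry, hb] at h'

lemma IsMatrixConvex.blockUpper_combo_mem (hΩ : IsMatrixConvex Ω) (hn : 0 < n)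
    {X Z Y X' Z' Y' : Mat n n E}
    (h : blockUpper X Z Y ∈ Ω (n + n)) (h' : blockUpper X' Z' Y' ∈ Ω (n + n)) {a b : ℝ}
    (ha : 0 ≤ a) (hb : 0 ≤ b) (hab : a + b = 1) :
    blockUpper ((a : ℂ) • X + (b : ℂ) • X') ((a : ℂ) • Z + (b : ℂ) • Z')
      ((a : ℂ) • Y + (b : ℂ) • Y') ∈ Ω (n + n) := by
  have := hΩ.combo_mem (by omega) h h' ha hb hab
  rwa [smul_blockUpper, smul_blockUpper, blockUpper_add] at this

lemma IsMatrixConvex.of_ampliation_mem (hΩ : IsMatrixConvex Ω) (hn : 0 < n) {w : Mat 1 1 E}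
    (h : ampliation n w ∈ Ω n) : w ∈ Ω 1 := by
  let V : Matrix (Fin n) (Fin 1) ℂ := Matrix.of fun i _ => if i = ⟨0, hn⟩ then 1 else 0
  have hV : V.conjTranspose * V = 1 := by
    ext i j
    simp [V, Matrix.mul_apply, Matrix.one_apply, Subsingleton.elim i j]
  have h' := hΩ.compress_mem n 1 hn one_pos _ h V hV
  have : sandwich V.conjTranspose (ampliation n w) V = w := by
    ext i j
    simp [V, sandwich, ampliation, Matrix.diagonal_apply, ite_smul, apply_ite (starRingEnd ℂ),
      Subsingleton.elim i 0, Subsingleton.elim j 0]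
  rwa [this] at h'

/-- If `[X, t(X - W); 0, W]` lies in `Ω` then `W` can be pushed away from `X` inside `Ω` by an
amount of order `t²`. -/
lemma IsMatrixConvex.exists_push (hΩ : IsMatrixConvex Ω) (hn : 0 < n) {T : ℝ} (hT : 0 < T) :
    ∃ κ : ℝ, 0 < κ ∧ ∀ X W : Mat n n E, ∀ t : ℝ, 0 < t → t ≤ T →
      blockUpper X ((t : ℂ) • (X - W)) W ∈ Ω (n + n) →
      ∃ ε : ℝ, 0 < ε ∧ κ * t ≤ ε ∧ ε ^ 2 ≤ 1 ∧ ∃ W' ∈ Ω n,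
        W = ((ε ^ 2 : ℝ) : ℂ) • X + ((1 - ε ^ 2 : ℝ) : ℂ) • W' := by
  -- The bound on `c * T` gives `v ≥ 1/2` below; with `c ≤ 1/4` this makes `v - c ≥ 1/4`.
  obtain ⟨c, hc, hc4, hcT⟩ : ∃ c : ℝ, 0 < c ∧ c ≤ 1 / 4 ∧ c * T ≤ 1 / 2 := by
    refine ⟨min (1 / 4) (1 / (2 * T)), by positivity, min_le_left _ _, ?_⟩
    calc min (1 / 4) (1 / (2 * T)) * T ≤ 1 / (2 * T) * T :=
          mul_le_mul_of_nonneg_right (min_le_right _ _) hT.le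
      _ = 1 / 2 := by field_simp
  refine ⟨√(c / 4 / (1 + T)), by positivity, fun X W t ht htT h => ?_⟩
  have hτ : c * t ≤ 1 / 2 := (mul_le_mul_of_nonneg_left htT hc.le).trans hcT
  have hτ0 : 0 < c * t := by positivity
  set v := √(1 - (c * t) ^ 2) with hv
  have hv2 : v ^ 2 = 1 - (c * t) ^ 2 := Real.sq_sqrt (by nlinarith)
  have hv0 : 0 ≤ v := Real.sqrt_nonneg _
  have hv1 : 1 / 2 ≤ v := Real.le_sqrt_of_sq_le (by nlinarith)
  have hv3 : v ≤ 1 := by nlinarith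
  -- The negative sign is the key: the compression equals `(1 + a) W - a X`, which lies beyond `W`
  -- on the ray from `X`. Solving for `W` forces `ε² = a / (1 + a)`.
  have hW' := hΩ.compress_blockUpper hn h (a := -(c * t)) (b := v) (by rw [hv2]; ring)
  set a := c * t * v * t - (c * t) ^ 2 with ha
  have ha4 : c / 4 * t ^ 2 ≤ a := by
    have : a = c * t ^ 2 * (v - c) := by rw [ha]; ring
    rw [this]
    have : 0 < c * t ^ 2 := by positivity
    nlinarith
  have ha0 : 0 < a := lt_of_lt_of_le (by positivity) ha4
  have haT : a ≤ T := by
    have h1 : c * t * v ≤ 1 := by nlinarith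
    have h2 : c * t * v * t ≤ 1 * t := mul_le_mul_of_nonneg_right h1 ht.le
    nlinarith [sq_nonneg (c * t)]
  have hε : √(a / (1 + a)) ^ 2 = a / (1 + a) := Real.sq_sqrt (by positivity)
  refine ⟨√(a / (1 + a)), by positivity, ?_, ?_, _, hW', ?_⟩
  · rw [← Real.sqrt_sq ht.le, ← Real.sqrt_mul (by positivity)]
    apply Real.sqrt_le_sqrt
    rw [div_mul_eq_mul_div, div_le_div_iff₀ (by positivity) (by positivity)]
    have : 0 ≤ c / 4 * t ^ 2 := by positivity
    nlinarith
  · rw [hε, div_le_one (by positivity)]; linarith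
  · rw [hε]
    have h1 : (((-(c * t)) ^ 2 : ℝ) : ℂ) • X + ((-(c * t) * v : ℝ) : ℂ) • ((t : ℂ) • (X - W)) +
        ((v ^ 2 : ℝ) : ℂ) • W = -(a : ℂ) • X + (1 + (a : ℂ)) • W := by
      rw [hv2, ha]; push_cast; module
    rw [h1]
    have h2 : (1 + (a : ℂ)) ≠ 0 := by exact_mod_cast (by positivity : (1 + a : ℝ) ≠ 0)
    push_cast
    match_scalars <;> field_simp <;> ring

end Convex

-- Entrywise sup norms and boundedness.

attribute [local instance] Matrix.normedAddCommGroup Matrix.normedSpace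

section Norms

lemma continuous_blockUpper {E : Type*} [AddCommGroup E] [TopologicalSpace E] {n m : ℕ} :
    Continuous fun p : Mat n n E × Mat n m E × Mat m m E => blockUpper p.1 p.2.1 p.2.2 := by
  unfold blockUpper
  simp only [Matrix.reindex_apply]
  fun_prop

variable {E : Type*} [NormedAddCommGroup E] {n m : ℕ}

lemma norm_le_norm_blockUpper (X : Mat n n E) (Z : Mat n m E) (Y : Mat m m E) :
    ‖Z‖ ≤ ‖blockUpper X Z Y‖ := by
  rw [Matrix.norm_le_iff (norm_nonneg _)]
  intro i j
  rw [← blockUpper_castAdd_natAdd X Z Y]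
  exact Matrix.norm_entry_le_entrywise_sup_norm _

lemma exists_radius_blockUpper {U : Set (Mat (n + n) (n + n) E)} {X : Mat n n E}
    (h : U ∈ 𝓝 (directSum X X)) :
    ∃ ρ : ℝ, 0 < ρ ∧ ∀ Y Z W : Mat n n E, ‖Y - X‖ < ρ → ‖Z‖ < ρ → ‖W - X‖ < ρ →
      blockUpper Y Z W ∈ U := by
  have h' := (continuous_blockUpper.tendsto ((X, 0, X) : Mat n n E × Mat n n E × Mat n n E)) h
  obtain ⟨ρ, hρ, hb⟩ := Metric.mem_nhds_iff.1 h'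
  refine ⟨ρ, hρ, fun Y Z W hY hZ hW => hb (a := (Y, Z, W)) ?_⟩
  rw [Metric.mem_ball, Prod.dist_eq, max_lt_iff, Prod.dist_eq, max_lt_iff]
  exact ⟨by rwa [dist_eq_norm], by rwa [dist_zero_right], by rwa [dist_eq_norm]⟩

lemma exists_norm_le_of_isBddNc {d : ℕ} {Ω : GradedSet (Fin d → ℂ)} (h : IsBddNc Ω) :
    ∃ C : ℝ, 0 < C ∧ ∀ n : ℕ, 0 < n → ∀ X ∈ Ω n, ‖X‖ ≤ C := by
  obtain ⟨C, hC⟩ := h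
  refine ⟨max C 1, by positivity, fun n hn X hX => ?_⟩
  rw [Matrix.norm_le_iff (by positivity)]
  intro i j
  rw [pi_norm_le_iff_of_nonneg (by positivity)]
  intro k
  refine le_trans ?_ ((hC n hn X hX k).trans (le_max_left _ _))
  set A := Matrix.toEuclideanCLM (n := Fin n) (𝕜 := ℂ) (X.map fun x => x k) with hA
  have h1 : X i j k = A (EuclideanSpace.single j 1) i := by
    rw [hA, Matrix.ofLp_toEuclideanCLM]
    simp
  rw [h1]
  refine (PiLp.norm_apply_le _ i).trans ((A.le_opNorm _).trans ?_)
  simp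

end Norms

/-! ### Local boundedness implies continuity. -/

section Continuity

variable {E F : Type*} [NormedAddCommGroup E] [NormedSpace ℂ E] [NormedAddCommGroup F]
  [NormedSpace ℂ F] {Ω : GradedSet E} {n : ℕ}

/-- An nc function that is bounded near `X ⊕ X` is Lipschitz near `X`. -/
lemma IsNcFunction.continuousAt {f : GradedMap E F} (hf : IsNcFunction Ω f) (hΩ : IsNcSet Ω)
    (ho : ∀ n : ℕ, 0 < n → IsOpen (Ω n)) (hn : 0 < n) {X : Mat n n E} (hX : X ∈ Ω n)
    {U : Set (Mat (n + n) (n + n) E)} (hU : U ∈ 𝓝 (directSum X X)) {C : ℝ}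
    (hC : ∀ V ∈ U ∩ Ω (n + n), ‖f (n + n) V‖ ≤ C) : ContinuousAt (f n) X := by
  obtain ⟨ρ, hρ, hb⟩ := exists_radius_blockUpper (Filter.inter_mem hU
    ((ho (n + n) (by omega)).mem_nhds (hΩ n n hn hn X hX X hX)))
  obtain ⟨σ, hσ, hs⟩ := Metric.isOpen_iff.1 (ho n hn) X hX
  refine continuousAt_of_locally_lipschitz (lt_min hρ hσ) (2 * C / ρ) fun Y hY => ?_
  rcases eq_or_ne Y X with rfl | hne
  · simp
  have hYΩ : Y ∈ Ω n := hs (hY.trans_le (min_le_right _ _))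
  have hYρ := hY.trans_le (min_le_left _ _)
  rw [dist_eq_norm] at hYρ ⊢
  rw [dist_eq_norm]
  have hpos : 0 < ‖Y - X‖ := norm_pos_iff.2 (sub_ne_zero.2 hne)
  -- The off-diagonal block gets norm `ρ / 2`; the bound on its image `t (f Y - f X)` is then a
  -- Lipschitz estimate.
  set t : ℝ := ρ / (2 * ‖Y - X‖) with ht
  have ht0 : 0 < t := by positivity
  have hnt : ‖(t : ℂ)‖ = t := by rw [Complex.norm_real, Real.norm_of_nonneg ht0.le]
  have hmem := hb Y ((t : ℂ) • (Y - X)) X hYρ (by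
    rw [norm_smul, hnt, ht]
    calc ρ / (2 * ‖Y - X‖) * ‖Y - X‖ = ρ / 2 := by field_simp
      _ < ρ := by linarith) (by simpa using hρ)
  have h1 := hC _ hmem
  rw [hf.map_blockUpper hΩ hn hYΩ hX _ hmem.2] at h1
  have h2 := (norm_le_norm_blockUpper _ _ _).trans h1
  rw [norm_smul, hnt, ht, div_mul_eq_mul_div, div_le_iff₀ (by positivity)] at h2
  rw [div_mul_eq_mul_div, le_div_iff₀ hρ]
  linarith

end Continuity

/-! ### Operator norms and openness of `𝔻_Q`. -/

section Operators

variable {H K : Type*} [NormedAddCommGroup H] [InnerProductSpace ℂ H]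
  [NormedAddCommGroup K] [InnerProductSpace ℂ K] {n : ℕ}

lemma norm_entry_le_norm_toOp (T : Mat n n (H →L[ℂ] K)) : ‖T‖ ≤ ‖toOp T‖ := by
  refine (Matrix.norm_le_iff (norm_nonneg (toOp T))).2 fun i j => ?_
  refine ContinuousLinearMap.opNorm_le_bound _ (norm_nonneg _) fun h => ?_
  have h1 : T i j h = toOp T (PiLp.single 2 j h) i := by
    simp only [toOp, ContinuousLinearMap.comp_apply]
    rw [ContinuousLinearEquiv.coe_coe, PiLp.coe_symm_continuousLinearEquiv]
    simp only [ContinuousLinearMap.pi_apply, sum_apply,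
      ContinuousLinearMap.comp_apply, PiLp.proj_apply]
    rw [Finset.sum_eq_single j] <;> simp +contextual
  rw [h1]
  refine (PiLp.norm_apply_le _ i).trans (((toOp T).le_opNorm _).trans ?_)
  simp

lemma continuous_toOp : Continuous (toOp : Mat n n (H →L[ℂ] K) → _) := by
  have : (toOp : Mat n n (H →L[ℂ] K) → _) = fun T => ∑ i, ∑ j,
      (((PiLp.continuousLinearEquiv 2 ℂ (fun _ : Fin n => K)).symm :
        (Fin n → K) →L[ℂ] PiLp 2 (fun _ : Fin n => K)) ∘L
        ContinuousLinearMap.single ℂ (fun _ : Fin n => K) i) ∘L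
        (T i j ∘L PiLp.proj 2 (fun _ : Fin n => H) j) := by
    funext T
    ext h k
    simp [toOp, Pi.single_apply]
  rw [this]
  refine continuous_finsetSum _ fun i _ => continuous_finsetSum _ fun j _ => ?_
  exact continuous_const.clm_comp ((continuous_id.matrix_elem i j).clm_comp continuous_const)

lemma isOpen_ncBall {E : Type*} [NormedAddCommGroup E] [NormedSpace ℂ E] {Ω : GradedSet E}
    (hΩ : IsNcDomain Ω) {Q : GradedMap E (H →L[ℂ] K)} (hQ : IsNcAnalytic Ω Q) (hn : 0 < n) :
    IsOpen (ncBall Ω Q n) := by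
  rw [isOpen_iff_mem_nhds]
  rintro X ⟨hX, hX1⟩
  obtain ⟨U, hU, C, hC⟩ := hQ.locallyBounded (n + n) (by omega) _
    (hΩ.isNcSet n n hn hn X hX X hX)
  have hc := hQ.isNcFunction.continuousAt hΩ.isNcSet hΩ.isOpen hn hX hU
    fun V hV => (norm_entry_le_norm_toOp _).trans (hC V hV)
  have hnorm : Continuous fun T : Mat n n (H →L[ℂ] K) => ‖toOp T‖ :=
    (continuous_norm (E := PiLp 2 (fun _ : Fin n => H) →L[ℂ] PiLp 2 (fun _ : Fin n => K))).comp
      continuous_toOp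
  have hc' : ContinuousAt (fun Z => ‖toOp (Q n Z)‖) X :=
    ContinuousAt.comp (f := Q n) hnorm.continuousAt hc
  filter_upwards [(hΩ.isOpen n hn).mem_nhds hX, hc'.eventually_lt_const hX1] with Z h1 h2
  exact ⟨h1, h2⟩

end Operators

/-! ### Harnack-type estimates and strict contraction. -/

section Harnack

variable {E : Type*} [NormedAddCommGroup E] [NormedSpace ℂ E] {Ω : GradedSet E} {n : ℕ}

lemma norm_ofReal_smul {V : Type*} [SeminormedAddCommGroup V] [NormedSpace ℂ V] {t : ℝ}
    (ht : 0 ≤ t) (v : V) : ‖(t : ℂ) • v‖ = t * ‖v‖ := by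
  rw [norm_smul, Complex.norm_real, Real.norm_of_nonneg ht]

/-- The shear `[X, t(X - W); 0, W]` can be moved from `X'` to a nearby `X` at the cost of a factor
`1 - η`, uniformly in `W`. -/
lemma IsMatrixConvex.eventually_shear_mem (hΩ : IsMatrixConvex Ω)
    (ho : ∀ n : ℕ, 0 < n → IsOpen (Ω n)) (hn : 0 < n) {X : Mat n n E} (hX : X ∈ Ω n)
    {T η : ℝ} (hT : 0 < T) (hη : 0 < η) (hη1 : η < 1) :
    ∀ᶠ X' in 𝓝 X, ∀ W ∈ Ω n, ∀ t : ℝ, 0 ≤ t → t ≤ T →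
      blockUpper X' ((t : ℂ) • (X' - W)) W ∈ Ω (n + n) →
      blockUpper X ((((1 - η) * t : ℝ) : ℂ) • (X - W)) W ∈ Ω (n + n) := by
  obtain ⟨κ, hκ, hpush⟩ := hΩ.exists_push hn hT
  obtain ⟨ρ, hρ, hb⟩ := exists_radius_blockUpper
    ((ho (n + n) (by omega)).mem_nhds (hΩ.isNcSet n n hn hn X hX X hX))
  have hσ : 0 < min ρ (η * ρ * min 1 κ) := by positivity
  filter_upwards [Metric.ball_mem_nhds X hσ] with X' hX' W hW t ht htT h
  rw [Metric.mem_ball, dist_eq_norm, lt_min_iff] at hX'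
  rcases ht.eq_or_lt with rfl | ht
  · simpa [directSum] using hΩ.isNcSet n n hn hn X hX W hW
  obtain ⟨ε, hε, hκε, hε1, W', hW', hWW'⟩ := hpush X' W t ht htT h
  have hηℂ : (η : ℂ) ≠ 0 := by exact_mod_cast hη.ne'
  have hεℂ : (ε : ℂ) ≠ 0 := by exact_mod_cast hε.ne'
  have hD : ‖X - X'‖ < η * ρ * min 1 κ := by rw [norm_sub_rev]; exact hX'.2
  have hη1' : 0 ≤ 1 - η := by linarith
  -- `Y` and `B` solve `X = (1 - η) X' + η Y` and `(1 - η) t (X - W) = (1 - η) t (X' - W) + η ε B`.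
  -- Since `κ t ≤ ε`, the factor `t / ε` in `B` is bounded independently of `W` and `t`.
  set Y : Mat n n E := X' + ((1 / η : ℝ) : ℂ) • (X - X') with hY
  set B : Mat n n E := (((1 - η) * (t / ε) / η : ℝ) : ℂ) • (X - X') with hB
  have hYX : ‖Y - X‖ < ρ := by
    have h1 : Y - X = (((1 - η) / η : ℝ) : ℂ) • (X - X') := by
      rw [hY]; push_cast; match_scalars <;> field_simp; ring
    rw [h1, norm_ofReal_smul (by positivity)]
    have h2 : ‖X - X'‖ < η * ρ :=
      hD.trans_le (mul_le_of_le_one_right (by positivity) (min_le_left _ _))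
    rw [div_mul_eq_mul_div, div_lt_iff₀ hη]
    nlinarith [norm_nonneg (X - X')]
  have hBρ : ‖B‖ < ρ := by
    rw [hB, norm_ofReal_smul (by positivity)]
    have h2 : ‖X - X'‖ < η * ρ * κ :=
      hD.trans_le (mul_le_mul_of_nonneg_left (min_le_right _ _) (by positivity))
    have h3 : (1 - η) * (t / ε) / η ≤ 1 / κ / η := by
      gcongr
      calc (1 - η) * (t / ε) ≤ 1 * (t / ε) := by gcongr; linarith
        _ ≤ 1 / κ := by rw [one_mul, div_le_div_iff₀ hε hκ]; linarith
    calc _ ≤ 1 / κ / η * ‖X - X'‖ := by gcongr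
      _ < 1 / κ / η * (η * ρ * κ) := by gcongr
      _ = ρ := by field_simp
  have hst := hΩ.stretch_mem hn (hb Y B X' hYX hBρ hX'.1) hW' hε1
  rw [← hWW'] at hst
  have hfin := hΩ.blockUpper_combo_mem hn h hst hη1' hη.le (by ring)
  convert hfin using 2
  · rw [hY]; push_cast; match_scalars <;> field_simp; ring
  · rw [hB]; push_cast; match_scalars <;> field_simp; ring
  · push_cast; module

/-- Points of `Ω` are pushed strictly towards each other by the scaling `r < 1`, in the sense of
the Lempert function. -/
lemma IsMatrixConvex.exists_contraction (hΩ : IsMatrixConvex Ω)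
    (ho : ∀ n : ℕ, 0 < n → IsOpen (Ω n)) (h0 : 0 ∈ Ω 1) (hn : 0 < n) {C : ℝ} (hC : 0 < C)
    (hb : ∀ X ∈ Ω (n + n), ‖X‖ ≤ C) {r : ℝ} (hr : 0 < r) (hr1 : r < 1) :
    ∃ q : ℝ, 1 < q ∧ ∀ X Y : Mat n n E, ∀ s : ℝ, 0 ≤ s →
      blockUpper X ((s : ℂ) • (X - Y)) Y ∈ Ω (n + n) →
      blockUpper ((r : ℂ) • X) (((s * q : ℝ) : ℂ) • ((r : ℂ) • X - (r : ℂ) • Y))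
        ((r : ℂ) • Y) ∈ Ω (n + n) := by
  have h0n := zero_mem_level hΩ.isNcSet h0 hn
  obtain ⟨ρ, hρ, hball⟩ := exists_radius_blockUpper
    ((ho (n + n) (by omega)).mem_nhds (hΩ.isNcSet n n hn hn 0 h0n 0 h0n))
  have hr1' : 0 < 1 - r := by linarith
  -- The gain comes from averaging with a triangular point near `0` whose off-diagonal block is
  -- parallel to `X - Y`, with weights `r` and `1 - r`.
  refine ⟨1 + (1 - r) * (ρ / (2 * C)) / r, by simp; positivity, fun X Y s hs h => ?_⟩
  have hZ : ‖(s : ℂ) • (X - Y)‖ ≤ C := (norm_le_norm_blockUpper _ _ _).trans (hb _ h)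
  have hB := hball 0 (((ρ / (2 * C) : ℝ) : ℂ) • (s : ℂ) • (X - Y)) 0 (by simpa using hρ) (by
    rw [norm_ofReal_smul (by positivity)]
    calc _ ≤ ρ / (2 * C) * C := by gcongr
      _ = ρ / 2 := by field_simp
      _ < ρ := by linarith) (by simpa using hρ)
  have hfin := hΩ.blockUpper_combo_mem hn h hB hr.le hr1'.le (by ring)
  have hrℂ : (r : ℂ) ≠ 0 := by exact_mod_cast hr.ne'
  have hCℂ : (C : ℂ) ≠ 0 := by exact_mod_cast hC.ne'
  convert hfin using 2
  · simp
  · push_cast; match_scalars <;> field_simp; ring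
  · simp

lemma exists_pos_shear_mem (hΩ : IsNcSet Ω) (ho : ∀ n : ℕ, 0 < n → IsOpen (Ω n)) (hn : 0 < n)
    {X Y : Mat n n E} (hX : X ∈ Ω n) (hY : Y ∈ Ω n) :
    ∃ s : ℝ, 0 < s ∧ blockUpper X ((s : ℂ) • (X - Y)) Y ∈ Ω (n + n) := by
  have hc : Continuous fun s : ℝ => blockUpper X ((s : ℂ) • (X - Y)) Y :=
    continuous_blockUpper.comp (continuous_const.prodMk
      ((Complex.continuous_ofReal.smul continuous_const).prodMk continuous_const))
  have hev : ∀ᶠ s : ℝ in 𝓝[>] 0, blockUpper X ((s : ℂ) • (X - Y)) Y ∈ Ω (n + n) := by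
    apply Filter.Eventually.filter_mono nhdsWithin_le_nhds
    refine hc.continuousAt.eventually_mem ((ho (n + n) (by omega)).mem_nhds ?_)
    simpa [directSum] using hΩ n n hn hn X hX Y hY
  obtain ⟨s, hs, hs0⟩ := (hev.and self_mem_nhdsWithin).exists
  exact ⟨s, hs0, hs⟩

lemma IsMatrixConvex.smul_mem_of_mem_closure (hΩ : IsMatrixConvex Ω)
    (ho : ∀ n : ℕ, 0 < n → IsOpen (Ω n)) (h0 : 0 ∈ Ω 1) (hn : 0 < n) {X : Mat n n E}
    (hX : X ∈ closure (Ω n)) {r : ℝ} (hr : 0 ≤ r) (hr1 : r < 1) : (r : ℂ) • X ∈ Ω n := by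
  obtain ⟨ρ, hρ, hball⟩ := Metric.isOpen_iff.1 (ho n hn) 0 (zero_mem_level hΩ.isNcSet h0 hn)
  have hr1' : 0 < 1 - r := by linarith
  obtain ⟨Z, hZ, hXZ⟩ := Metric.mem_closure_iff.1 hX (ρ * (1 - r)) (by positivity)
  rw [dist_eq_norm] at hXZ
  have hW : ((r / (1 - r) : ℝ) : ℂ) • (X - Z) ∈ Ω n := by
    apply hball
    rw [Metric.mem_ball, dist_zero_right, norm_ofReal_smul (by positivity), div_mul_eq_mul_div,
      div_lt_iff₀ hr1']
    nlinarith [norm_nonneg (X - Z)]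
  have h := hΩ.combo_mem hn hZ hW hr hr1'.le (by ring)
  have hrℂ : (1 - (r : ℂ)) ≠ 0 := by exact_mod_cast hr1'.ne'
  convert h using 1
  push_cast; match_scalars <;> field_simp; ring

end Harnack

/-! ### Earle–Hamilton iteration. -/

section FixedPoint

variable {E : Type*} [NormedAddCommGroup E] [NormedSpace ℂ E] {Ω : GradedSet E} {n : ℕ}
  {f : GradedMap E E}

/-- The Earle–Hamilton fixed point theorem for `r f` with `r < 1`. -/
lemma IsNcFunction.exists_fixedPoint_smul [FiniteDimensional ℂ E] (hf : IsNcFunction Ω f)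
    (hΩ : IsMatrixConvex Ω) (ho : ∀ n : ℕ, 0 < n → IsOpen (Ω n)) (h0 : 0 ∈ Ω 1)
    (hmaps : ∀ n : ℕ, 0 < n → Set.MapsTo (f n) (Ω n) (Ω n)) (hn : 0 < n)
    (hcont : ∀ X ∈ Ω n, ContinuousAt (f n) X) {C : ℝ} (hC : 0 < C)
    (hb : ∀ X ∈ Ω (n + n), ‖X‖ ≤ C) {r : ℝ} (hr : 0 < r) (hr1 : r < 1) :
    ∃ W ∈ Ω n, (r : ℂ) • f n W = W := by
  obtain ⟨q, hq, hcontr⟩ := hΩ.exists_contraction ho h0 hn hC hb hr hr1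
  set g : Mat n n E → Mat n n E := fun X => (r : ℂ) • f n X with hg
  have hgΩ : Set.MapsTo g (Ω n) (Ω n) := fun X hX => hΩ.smul_mem h0 hn (hmaps n hn hX) hr.le hr1.le
  have h0n := zero_mem_level hΩ.isNcSet h0 hn
  set x : ℕ → Mat n n E := fun m => g^[m] 0 with hx
  have hxs : ∀ m, x (m + 1) = g (x m) := fun m => Function.iterate_succ_apply' g m 0
  have hxΩ : ∀ m, x m ∈ Ω n := fun m => hgΩ.iterate m h0n
  obtain ⟨s, hs, hs1⟩ := exists_pos_shear_mem hΩ.isNcSet ho hn (hxΩ 0) (hxΩ 1)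
  have hq0 : 0 < q := by linarith
  -- The shear parameter grows like `q ^ m` while `Ω` is bounded, so successive distances decay
  -- geometrically.
  have hshear : ∀ m, blockUpper (x m) (((s * q ^ m : ℝ) : ℂ) • (x m - x (m + 1))) (x (m + 1)) ∈
      Ω (n + n) := by
    intro m
    induction m with
    | zero => simpa using hs1
    | succ m ih =>
      have h1 := hcontr _ _ _ (by positivity)
        (hf.shear_mem hΩ.isNcSet hmaps hn (hxΩ m) (hxΩ (m + 1)) _ ih)
      rw [mul_assoc, ← pow_succ] at h1
      rw [hxs m, hxs (m + 1)]
      exact h1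
  have hdist : ∀ m, dist (x m) (x (m + 1)) ≤ C / s * (1 / q) ^ m := by
    intro m
    have h1 := (norm_le_norm_blockUpper _ _ _).trans (hb _ (hshear m))
    rw [norm_ofReal_smul (by positivity), ← dist_eq_norm] at h1
    rw [div_pow, one_pow, div_mul_div_comm, mul_one, le_div_iff₀ (by positivity)]
    linarith
  have : CompleteSpace (Mat n n E) := FiniteDimensional.complete ℂ _
  obtain ⟨W, hW⟩ := cauchySeq_tendsto_of_complete
    (cauchySeq_of_le_geometric (1 / q) (C / s) (by rw [div_lt_one hq0]; exact hq) hdist)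
  have hrℂ : (r : ℂ) ≠ 0 := by exact_mod_cast hr.ne'
  have hW1 : Filter.Tendsto (fun m => x (m + 1)) Filter.atTop (𝓝 W) :=
    hW.comp (Filter.tendsto_add_atTop_nat 1)
  have hWΩ : W ∈ Ω n := by
    -- `r⁻¹ W` is the limit of the points `f (x m)` of `Ω`; scaling back by `r < 1` moves it from
    -- the closure into `Ω`.
    have h1 : (r : ℂ)⁻¹ • W ∈ closure (Ω n) := by
      refine mem_closure_of_tendsto (hW1.const_smul (r : ℂ)⁻¹) (Filter.Eventually.of_forall ?_)
      intro m
      rw [hxs, hg, inv_smul_smul₀ hrℂ]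
      exact hmaps n hn (hxΩ m)
    have h2 := hΩ.smul_mem_of_mem_closure ho h0 hn h1 hr.le hr1
    rwa [smul_inv_smul₀ hrℂ] at h2
  refine ⟨W, hWΩ, ?_⟩
  have h1 : Filter.Tendsto (fun m => x (m + 1)) Filter.atTop (𝓝 (g W)) := by
    simp only [hxs]
    exact ((hcont W hWΩ).tendsto.comp hW).const_smul (r : ℂ)
  exact tendsto_nhds_unique h1 hW1

end FixedPoint

/-! ### Contraction and comparison for the Lempert function. -/

section Lempert

variable {E : Type*} [AddCommGroup E] [Module ℂ E] {Ω : GradedSet E} {n : ℕ}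

lemma IsNcFunction.const_smul {F : Type*} [AddCommGroup F] [Module ℂ F] {f : GradedMap E F}
    (hf : IsNcFunction Ω f) (r : ℂ) : IsNcFunction Ω fun n X => r • f n X where
  map_directSum n m hn hm X hX Y hY := by
    rw [hf.map_directSum n m hn hm X hX Y hY, directSum, smul_blockUpper, smul_zero, directSum]
  map_similarity n hn X hX S h := by
    simp only [hf.map_similarity n hn X hX S h]
    ext i j
    simp [sandwich, Finset.smul_sum, smul_comm r]

/-- Self-maps of `Ω` contract `δ~`. -/
lemma IsNcFunction.lempertDist_map_le {f : GradedMap E E} (hf : IsNcFunction Ω f) (hΩ : IsNcSet Ω)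
    (hmaps : ∀ n : ℕ, 0 < n → Set.MapsTo (f n) (Ω n) (Ω n)) (hn : 0 < n)
    {X Y : Mat n n E} (hX : X ∈ Ω n) (hY : Y ∈ Ω n) :
    lempertDist Ω (f n X) (f n Y) ≤ lempertDist Ω X Y := by
  refine ENNReal.inv_le_inv.2 (sSup_le_sSup fun t ht s hs => ?_)
  exact hf.shear_mem hΩ hmaps hn hX hY _ (ht s hs)

lemma IsNcFunction.lempertDist_iterate_le {f : GradedMap E E} (hf : IsNcFunction Ω f)
    (hΩ : IsNcSet Ω) (hmaps : ∀ n : ℕ, 0 < n → Set.MapsTo (f n) (Ω n) (Ω n)) (hn : 0 < n)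
    {X W : Mat n n E} (hX : X ∈ Ω n) (hW : W ∈ Ω n) (hfW : f n W = W) (k : ℕ) :
    lempertDist Ω ((f n)^[k] X) W ≤ lempertDist Ω X W := by
  induction k with
  | zero => exact le_rfl
  | succ k ih =>
    rw [Function.iterate_succ_apply']
    refine le_trans ?_ ih
    conv_lhs => rw [← hfW]
    exact hf.lempertDist_map_le hΩ hmaps hn ((hmaps n hn).iterate k hX) hW

lemma lempertDist_le_inv_mul {X X' W : Mat n n E} {c : ℝ} (hc : 0 < c)
    (h : ∀ t : ℝ, 0 ≤ t → blockUpper X' ((t : ℂ) • (X' - W)) W ∈ Ω (n + n) →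
      blockUpper X (((c * t : ℝ) : ℂ) • (X - W)) W ∈ Ω (n + n)) :
    lempertDist Ω X W ≤ ENNReal.ofReal c⁻¹ * lempertDist Ω X' W := by
  have hc0 : ENNReal.ofReal c ≠ 0 := (ENNReal.ofReal_pos.2 hc).ne'
  rw [ENNReal.ofReal_inv_of_pos hc]
  unfold lempertDist lempert
  rw [← ENNReal.mul_inv (Or.inl hc0) (Or.inl ENNReal.ofReal_ne_top), ENNReal.inv_le_inv,
    ENNReal.mul_sSup]
  refine iSup₂_le fun t ht => le_sSup fun s hs => ?_
  have h1 := ht (s / c.toNNReal) (by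
    rw [ENNReal.coe_div (Real.toNNReal_pos.2 hc).ne']
    exact ENNReal.div_lt_of_lt_mul' hs)
  have h2 := h _ (NNReal.coe_nonneg _) h1
  have h3 : c * ((s / c.toNNReal : ℝ≥0) : ℝ) = s := by
    rw [NNReal.coe_div, Real.coe_toNNReal _ hc.le]; field_simp
  rwa [h3] at h2

end Lempert

/-! ### Boundary fixed-point limits and horospheres. -/

section Wolff

variable {d : ℕ} {Ω : GradedSet (Fin d → ℂ)} {f : GradedMap (Fin d → ℂ) (Fin d → ℂ)}

lemma IsNcFunction.continuousAt_of_mapsTo (hf : IsNcFunction Ω f) (hΩ : IsNcSet Ω)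
    (ho : ∀ n : ℕ, 0 < n → IsOpen (Ω n)) (hbdd : IsBddNc Ω)
    (hmaps : ∀ n : ℕ, 0 < n → Set.MapsTo (f n) (Ω n) (Ω n)) {n : ℕ} (hn : 0 < n)
    {X : Mat n n (Fin d → ℂ)} (hX : X ∈ Ω n) : ContinuousAt (f n) X := by
  obtain ⟨C, -, hC⟩ := exists_norm_le_of_isBddNc hbdd
  exact hf.continuousAt hΩ ho hn hX Filter.univ_mem
    fun V hV => hC (n + n) (by omega) _ (hmaps (n + n) (by omega) hV.2)

/-- The fixed points of `r f`, `r → 1`, accumulate at a boundary point if `f` has none. -/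
lemma IsNcFunction.exists_boundary_sequence (hf : IsNcFunction Ω f) (hΩ : IsMatrixConvex Ω)
    (ho : ∀ n : ℕ, 0 < n → IsOpen (Ω n)) (hbdd : IsBddNc Ω) (h0 : 0 ∈ Ω 1)
    (hmaps : ∀ n : ℕ, 0 < n → Set.MapsTo (f n) (Ω n) (Ω n))
    (hfix : ∀ X ∈ Ω 1, f 1 X ≠ X) :
    ∃ ξ ∈ frontier (Ω 1), ∃ (r : ℕ → ℝ) (w : ℕ → Mat 1 1 (Fin d → ℂ)),
      Filter.Tendsto r Filter.atTop (𝓝 1) ∧ Filter.Tendsto w Filter.atTop (𝓝 ξ) ∧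
      ∀ j, 0 < r j ∧ r j < 1 ∧ w j ∈ Ω 1 ∧ (r j : ℂ) • f 1 (w j) = w j := by
  obtain ⟨C, hC, hb⟩ := exists_norm_le_of_isBddNc hbdd
  obtain ⟨r, -, hr, hr1⟩ := exists_seq_strictMono_tendsto' (zero_lt_one' ℝ)
  have hex := fun j => hf.exists_fixedPoint_smul hΩ ho h0 hmaps one_pos
    (fun X hX => hf.continuousAt_of_mapsTo hΩ.isNcSet ho hbdd hmaps one_pos hX) hC
    (hb 2 two_pos) (hr j).1 (hr j).2
  choose w hw hfw using hex
  have : ProperSpace (Mat 1 1 (Fin d → ℂ)) := FiniteDimensional.proper ℂ _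
  obtain ⟨ξ, hξ, φ, hφ, hlim⟩ := tendsto_subseq_of_bounded
    (isBounded_iff_forall_norm_le.2 ⟨C, hb 1 one_pos⟩) hw
  have hrφ := hr1.comp hφ.tendsto_atTop
  refine ⟨ξ, ?_, r ∘ φ, w ∘ φ, hrφ, hlim, fun j => ⟨(hr _).1, (hr _).2, hw _, hfw _⟩⟩
  rw [(ho 1 one_pos).frontier_eq]
  refine ⟨hξ, fun hmem => hfix ξ hmem ?_⟩
  have h1 := ((Complex.continuous_ofReal.tendsto 1).comp hrφ).smul
    ((hf.continuousAt_of_mapsTo hΩ.isNcSet ho hbdd hmaps one_pos hmem).tendsto.comp hlim)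
  rw [Complex.ofReal_one, one_smul] at h1
  refine tendsto_nhds_unique h1 (hlim.congr fun j => ?_)
  exact (hfw (φ j)).symm

lemma IsNcFunction.tendsto_iterate_smul (hf : IsNcFunction Ω f) (hΩ : IsNcSet Ω)
    (ho : ∀ n : ℕ, 0 < n → IsOpen (Ω n)) (hbdd : IsBddNc Ω)
    (hmaps : ∀ n : ℕ, 0 < n → Set.MapsTo (f n) (Ω n) (Ω n)) {n : ℕ} (hn : 0 < n)
    {Z : Mat n n (Fin d → ℂ)} (hZ : Z ∈ Ω n) {r : ℕ → ℝ}
    (hr : Filter.Tendsto r Filter.atTop (𝓝 1)) (k : ℕ) :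
    Filter.Tendsto (fun j => (fun X => (r j : ℂ) • f n X)^[k] Z) Filter.atTop
      (𝓝 ((f n)^[k] Z)) := by
  induction k with
  | zero => exact tendsto_const_nhds
  | succ k ih =>
    simp only [Function.iterate_succ_apply']
    have h1 := ((Complex.continuous_ofReal.tendsto 1).comp hr).smul
      ((hf.continuousAt_of_mapsTo hΩ ho hbdd hmaps hn ((hmaps n hn).iterate k hZ)).tendsto.comp ih)
    rwa [Complex.ofReal_one, one_smul] at h1

lemma continuous_ampliation {E : Type*} [AddCommGroup E] [TopologicalSpace E] (n : ℕ) :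
    Continuous (ampliation n : Mat 1 1 E → _) := by
  unfold ampliation
  fun_prop

/-- `δ~(·, W)` is almost lower semicontinuous, uniformly as `W` tends to a point `V ≠ X`. -/
lemma IsMatrixConvex.eventually_lempertDist_le (hΩ : IsMatrixConvex Ω)
    (ho : ∀ n : ℕ, 0 < n → IsOpen (Ω n)) (hbdd : IsBddNc Ω) {n : ℕ} (hn : 0 < n)
    {X V : Mat n n (Fin d → ℂ)} (hX : X ∈ Ω n) (hXV : X ≠ V) {c : ℝ} (hc : 0 < c) (hc1 : c < 1) :
    ∀ᶠ p : Mat n n (Fin d → ℂ) × Mat n n (Fin d → ℂ) in 𝓝 (X, V), p.2 ∈ Ω n →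
      lempertDist Ω X p.2 ≤ ENNReal.ofReal c⁻¹ * lempertDist Ω p.1 p.2 := by
  obtain ⟨C, hC, hb⟩ := exists_norm_le_of_isBddNc hbdd
  have hδ : 0 < ‖X - V‖ := norm_pos_iff.2 (sub_ne_zero.2 hXV)
  have h1 : ∀ᶠ p : Mat n n (Fin d → ℂ) × Mat n n (Fin d → ℂ) in 𝓝 (X, V),
      ‖X - V‖ / 2 < ‖p.1 - p.2‖ :=
    ((continuous_fst.sub continuous_snd).norm.continuousAt (x := (X, V))).eventually_const_lt
      (half_lt_self hδ)
  -- Any admissible `t` satisfies `t ‖p.1 - p.2‖ ≤ C`, and the distance stays above `‖X - V‖ / 2`;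
  -- hence this `T`.
  have h2 := hΩ.eventually_shear_mem ho hn hX (T := C / (‖X - V‖ / 2)) (η := 1 - c)
    (by positivity) (by linarith) (by linarith)
  rw [sub_sub_cancel] at h2
  filter_upwards [h1, continuous_fst.continuousAt.eventually h2] with p hp1 hp2 hpΩ
  refine lempertDist_le_inv_mul hc fun t ht h => hp2 p.2 hpΩ t ht ?_ h
  have h3 := (norm_le_norm_blockUpper _ _ _).trans (hb (n + n) (by omega) _ h)
  rw [norm_ofReal_smul ht] at h3
  rw [le_div_iff₀ (by positivity)]
  exact (mul_le_mul_of_nonneg_left hp1.le ht).trans h3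

/-- The Wolff theorem for an open, bounded, matrix convex set containing `0`. -/
lemma IsNcFunction.exists_wolff_point (hf : IsNcFunction Ω f) (hΩ : IsMatrixConvex Ω)
    (ho : ∀ n : ℕ, 0 < n → IsOpen (Ω n)) (hbdd : IsBddNc Ω) (h0 : 0 ∈ Ω 1)
    (hmaps : ∀ n : ℕ, 0 < n → Set.MapsTo (f n) (Ω n) (Ω n))
    (hfix : ∀ X ∈ Ω 1, f 1 X ≠ X) :
    ∃ ξ : Mat 1 1 (Fin d → ℂ), ξ ∈ frontier (Ω 1) ∧
      ∀ R : ℝ, 0 < R → ∀ k n : ℕ, 0 < n →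
        Set.MapsTo ((f n)^[k]) (smallHorosphere Ω ξ R n) (bigHorosphere Ω ξ R n) := by
  obtain ⟨ξ, hξ, r, w, hr, hw, hrw⟩ := hf.exists_boundary_sequence hΩ ho hbdd h0 hmaps hfix
  refine ⟨ξ, hξ, fun R hR k n hn Z hZ => ?_⟩
  obtain ⟨hZΩ, hZR⟩ := hZ
  have hξΩ : ξ ∉ Ω 1 := by
    rw [(ho 1 one_pos).frontier_eq] at hξ; exact hξ.2
  have hX : (f n)^[k] Z ∈ Ω n := (hmaps n hn).iterate k hZΩ
  refine ⟨hX, ?_⟩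
  have hXξ : (f n)^[k] Z ≠ ampliation n ξ := fun h => hξΩ (hΩ.of_ampliation_mem hn (h ▸ hX))
  obtain ⟨b, hb0, hZb, hbR⟩ := ENNReal.lt_iff_exists_real_btwn.1 hZR
  rw [ENNReal.ofReal_lt_ofReal_iff hR] at hbR
  -- With `b < R` above the limsup, this `c < 1` still leaves `c⁻¹ b = 2 R b / (b + R) < R`.
  have hc : 0 < (b + R) / (2 * R) := by positivity
  have hc1 : (b + R) / (2 * R) < 1 := by rw [div_lt_one (by positivity)]; linarith
  have hwin : Filter.Tendsto w Filter.atTop (𝓝[Ω 1] ξ) :=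
    tendsto_nhdsWithin_iff.2 ⟨hw, Filter.Eventually.of_forall fun j => (hrw j).2.2.1⟩
  have hcmp := ((hf.tendsto_iterate_smul hΩ.isNcSet ho hbdd hmaps hn hZΩ hr k).prodMk_nhds
    (((continuous_ampliation n).tendsto ξ).comp hw)).eventually
    (hΩ.eventually_lempertDist_le ho hbdd hn hX hXξ hc hc1)
  have hev : ∀ᶠ j in Filter.atTop, (lempertDist Ω 0 (w j))⁻¹ *
      lempertDist Ω ((f n)^[k] Z) (ampliation n (w j)) ≤
        ENNReal.ofReal ((b + R) / (2 * R))⁻¹ * ENNReal.ofReal b := by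
    filter_upwards [hcmp, hwin.eventually (Filter.eventually_lt_of_limsup_lt hZb)] with j h1 h2
    obtain ⟨hr0, hr1, hwΩ, hwf⟩ := hrw j
    have hg : ∀ n : ℕ, 0 < n → Set.MapsTo (fun X => (r j : ℂ) • f n X) (Ω n) (Ω n) :=
      fun n hn X hX => hΩ.smul_mem h0 hn (hmaps n hn hX) hr0.le hr1.le
    have hWΩ := ampliation_mem hΩ.isNcSet hwΩ hn
    have hgf := hf.const_smul (r j : ℂ)
    have h3 := hgf.lempertDist_iterate_le hΩ.isNcSet hg hn hZΩ hWΩ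
      (by rw [hgf.map_ampliation hΩ.isNcSet hwΩ hn, hwf]) k
    calc _ ≤ (lempertDist Ω 0 (w j))⁻¹ * (ENNReal.ofReal ((b + R) / (2 * R))⁻¹ *
          lempertDist Ω Z (ampliation n (w j))) :=
          mul_le_mul_right ((h1 hWΩ).trans (mul_le_mul_right h3 _)) _
      _ = ENNReal.ofReal ((b + R) / (2 * R))⁻¹ * ((lempertDist Ω 0 (w j))⁻¹ *
          lempertDist Ω Z (ampliation n (w j))) := mul_left_comm _ _ _
      _ ≤ _ := mul_le_mul_right h2.le _
  -- The estimate holds only along the sequence `w j → ξ`, so it bounds the liminf; hence the big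
  -- horosphere in the target.
  refine (Filter.liminf_le_of_frequently_le (hwin.frequently hev.frequently)).trans_lt ?_
  rw [← ENNReal.ofReal_mul (by positivity), ENNReal.ofReal_lt_ofReal_iff hR, inv_div,
    div_mul_eq_mul_div, div_lt_iff₀ (by positivity)]
  nlinarith

end Wolff

end NcIter

theorem mainTheorem6
    {d : ℕ}
    {H K : Type*} [NormedAddCommGroup H] [InnerProductSpace ℂ H] [CompleteSpace H]
    [NormedAddCommGroup K] [InnerProductSpace ℂ K] [CompleteSpace K]
    (Ω₀ : NcIter.GradedSet (Fin d → ℂ)) (hΩ₀ : NcIter.IsNcDomain Ω₀)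
    (Q : NcIter.GradedMap (Fin d → ℂ) (H →L[ℂ] K)) (hQ : NcIter.IsNcAnalytic Ω₀ Q)
    (Ω : NcIter.GradedSet (Fin d → ℂ)) (hΩ : Ω = NcIter.ncBall Ω₀ Q)
    (hconv : NcIter.IsMatrixConvex Ω) (hbdd : NcIter.IsBddNc Ω) (hzero : 0 ∈ Ω 1)
    (f : NcIter.GradedMap (Fin d → ℂ) (Fin d → ℂ))
    (hmaps : ∀ n : ℕ, 0 < n → Set.MapsTo (f n) (Ω n) (Ω n))
    (hf : NcIter.IsNcFunction Ω f)
    (hfix : ∀ n : ℕ, 0 < n → ∀ X ∈ Ω n, f n X ≠ X) :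
    ∃ ξ : NcIter.Mat 1 1 (Fin d → ℂ), ξ ∈ frontier (Ω 1) ∧
      ∀ R : ℝ, 0 < R → ∀ k n : ℕ, 0 < n →
        Set.MapsTo ((f n)^[k])
          (NcIter.smallHorosphere Ω ξ R n) (NcIter.bigHorosphere Ω ξ R n) := by
  have ho : ∀ n : ℕ, 0 < n → IsOpen (Ω n) := fun n hn => by
    rw [hΩ]; exact NcIter.isOpen_ncBall hΩ₀ hQ hn
  exact hf.exists_wolff_point hconv ho hbdd hzero hmaps (hfix 1 one_pos)
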